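/- Conventions. $\mathbf{InfSL}$ is the category of posets with finite meets (including a top element $\top$) and maps preserving finite meets. A cartesian category is a category $\mathcal C$ with chosen finite products, with terminal object $I$, regarded as a symmetric monoidal category $(\mathcal C,\times,I)$ in which every object $X$ carries the comonoid $\Delta_X=\langle \mathrm{id},\mathrm{id}\rangle$, $!_X : X\to I$; a strict cartesian functor is a strict monoidal functor preserving these comonoids. For $P:\mathcal C^{op}\to\mathbf{InfSL}$ write $P_f$ for the action of $P$ on $f$, and $\exists_f$ for the left adjoint of $P_f$ when it exists. An elementary existential doctrine is a functor $P:\mathcal C^{op}\to\mathbf{InfSL}$ on a cartesian category such that: (a) for every $A$ there is $\delta_A\in P(A\times A)$ such that, for all $X$ and $e=\mathrm{id}_X\times\Delta_A : X\times A\to X\times A\times A$, the assignment $\alpha\mapsto P_{\langle\pi_1,\pi_2\rangle}(\alpha)\wedge P_{\langle\pi_2,\pi_3\rangle}(\delta_A)$ is left adjoint to $P_e$; (b) $P_\pi$ has a left adjoint $\exists_\pi$ for every product projection $\pi$, and for $\pi : X\times A\to A$ one has the Beck–Chevalley condition $\exists_{\pi'}P_{f'}(\beta)=P_f\exists_\pi(\beta)$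 for every $\beta\in P(X\times A)$ and every pullback $\pi':X'\to A'$, $f':X'\to X\times A$ of $\pi$ along $f:A'\to A$, and Frobenius reciprocity $\exists_\pi(P_\pi(\alpha)\wedge\beta)=\alpha\wedge\exists_\pi(\beta)$ for $\alpha\in P(A)$, $\beta\in P(X\times A)$. A morphism in $\mathbf{EED}$ from $P:\mathcal C^{op}\to\mathbf{InfSL}$ to $R:\mathcal D^{op}\to\mathbf{InfSL}$ is a pair $(F,b)$ of a strict cartesian functor $F:\mathcal C\to\mathcal D$ and a natural transformation $b:P\to R\circ F^{op}$ with $b_{A\times A}(\delta^P_A)=\delta^R_{FA}$ and $b_A\circ\exists^P_\pi=\exists^R_{F\pi}\circ b_{X\times A}$ for every projection $\pi:X\times A\to A$; the composite of $(F,b)$ and $(G,c)$ is $(GF,cF\circ b)$. A cartesian bicategory is a symmetric monoidal category $(\mathcal B,\otimes,I)$ with partially ordered hom-sets, monotone composition (written $f;g$ in diagrammatic order) and monotone $\otimes$, in which every object $X$ carries a cocommutative comonoid $(d_X:X\to X\otimes X,\ e_X:X\to I)$, coherent with the monoidal structure, such that $d_X$, $e_X$ have right adjoints $d_X^*$, $e_X^*$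 (that is, $\mathrm{id}\le d_X;d_X^*$, $d_X^*;d_X\le\mathrm{id}$, $\mathrm{id}\le e_X;e_X^*$, $e_X^*;e_X\le\mathrm{id}$), the Frobenius law $(d_X\otimes\mathrm{id});(\mathrm{id}\otimes d_X^*)=d_X^*;d_X=(\mathrm{id}\otimes d_X);(d_X^*\otimes\mathrm{id})$ holds (associators suppressed), and $r;d_Y\le d_X;(r\otimes r)$ and $r;e_Y\le e_X$ for all $r:X\to Y$. Morphisms in $\mathbf{CBC}$ are the strict symmetric monoidal functors preserving the order, the comonoids and the monoids $(d_X^*,e_X^*)$. Theorem. Let $P:\mathcal C^{op}\to\mathbf{InfSL}$ be an elementary existential doctrine. Let $\mathcal B_P$ have the objects of $\mathcal C$, hom-posets $\mathcal B_P(X,Y)=P(X\times Y)$, identities $\delta_X$, and composition $$f;g=\exists_{\langle\pi_1,\pi_3\rangle}\bigl(P_{\langle\pi_1,\pi_2\rangle}(f)\wedge P_{\langle\pi_2,\pi_3\rangle}(g)\bigr)\quad(\text{projections from } X\times Y\times Z)$$ for $f\in P(X\times Y)$, $g\in P(Y\times Z)$; tensor $X\otimes Y=X\times Y$ on objects and,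 for $f\in P(A\times B)$, $g\in P(C\times D)$, $$f\otimes g=P_{\langle\pi_1,\pi_3\rangle}(f)\wedge P_{\langle\pi_2,\pi_4\rangle}(g)\in P(A\times C\times B\times D).$$ For $f:X\to Y$ in $\mathcal C$ let $\Gamma_P(f)=P_{f\times\mathrm{id}_Y}(\delta_Y)\in P(X\times Y)$. 1. $\Gamma_P$ preserves identities, composition and tensor of morphisms: $\Gamma_P(\mathrm{id}_X)=\delta_X$, $\Gamma_P(g\circ f)=\Gamma_P(f);\Gamma_P(g)$ and $\Gamma_P(f\times g)=\Gamma_P(f)\otimes\Gamma_P(g)$. 2. With unit object $I$, with associators, unitors and symmetries the images under $\Gamma_P$ of those of $\mathcal C$, with comonoids $\Gamma_P(\Delta_X)$, $\Gamma_P(!_X)$, and with right adjoints of these given by $P_{\mathrm{id}\times\Delta_X}(\delta_{X\times X})$ and $P_{\mathrm{id}\times !_X}(\delta_I)$, $\mathcal B_P$ is a cartesian bicategory. 3. The assignment $P\mapsto\mathcal B_P$ extends to a functor $\mathcal L:\mathbf{EED}\to\mathbf{CBC}$ which sends $(F,b):P\to R$ to the morphism $\mathcal B_P\to\mathcal B_R$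 given by $X\mapsto FX$ on objects and by $P(X\times Y)\ni r\mapsto b_{X\times Y}(r)\in R(F(X)\times F(Y))$ on morphisms. -/

import Mathlib

open CategoryTheory MonoidalCategory CartesianMonoidalCategory ComonObj Opposite

universe u v w u₁ v₁ u₂ v₂ u₃ v₃

namespace DoctrineCB

/-! ### Strict monoidal and strict cartesian functors -/

/-- A functor that preserves the whole monoidal structure on the nose. As the two sides of the
equations between morphisms have propositionally equal end points, they are compared with `HEq`. -/
structure IsStrictMonoidal {C : Type u₁} [Category.{v₁} C] [MonoidalCategory C]
    {D : Type u₂} [Category.{v₂} D] [MonoidalCategory D] (F : C ⥤ D) : Prop where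
  obj_unit : F.obj (𝟙_ C) = 𝟙_ D
  obj_tensor (X Y : C) : F.obj (X ⊗ Y) = F.obj X ⊗ F.obj Y
  map_tensor {X X' Y Y' : C} (f : X ⟶ X') (g : Y ⟶ Y') :
    HEq (F.map (f ⊗ₘ g)) (F.map f ⊗ₘ F.map g)
  map_associator (X Y Z : C) :
    HEq (F.map (α_ X Y Z).hom) (α_ (F.obj X) (F.obj Y) (F.obj Z)).hom
  map_leftUnitor (X : C) : HEq (F.map (λ_ X).hom) (λ_ (F.obj X)).hom
  map_rightUnitor (X : C) : HEq (F.map (ρ_ X).hom) (ρ_ (F.obj X)).hom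

/-- The diagonal `⟨id, id⟩` of a cartesian category. -/
abbrev diag {C : Type u₁} [Category.{v₁} C] [CartesianMonoidalCategory C] (X : C) : X ⟶ X ⊗ X :=
  lift (𝟙 X) (𝟙 X)

/-- A morphism of cartesian categories: a strict monoidal functor that preserves the comonoids
`(⟨id, id⟩, !)`. -/
structure IsStrictCartesian {C : Type u₁} [Category.{v₁} C] [CartesianMonoidalCategory C]
    {D : Type u₂} [Category.{v₂} D] [CartesianMonoidalCategory D] (F : C ⥤ D) : Prop
    extends IsStrictMonoidal F where
  map_diag (X : C) : HEq (F.map (diag X)) (diag (F.obj X))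
  map_toUnit (X : C) : HEq (F.map (toUnit X)) (toUnit (F.obj X))

theorem map_heq {C : Type u₁} [Category.{v₁} C] {D : Type u₂} [Category.{v₂} D] (F : C ⥤ D)
    {X X' Y Y' : C} {f : X ⟶ Y} {f' : X' ⟶ Y'} (hX : X = X') (hY : Y = Y') (h : HEq f f') :
    HEq (F.map f) (F.map f') := by
  subst hX hY; cases h; rfl

theorem IsStrictMonoidal.id (C : Type u₁) [Category.{v₁} C] [MonoidalCategory C] :
    IsStrictMonoidal (𝟭 C) where
  obj_unit := rfl
  obj_tensor _ _ := rfl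
  map_tensor _ _ := HEq.rfl
  map_associator _ _ _ := HEq.rfl
  map_leftUnitor _ := HEq.rfl
  map_rightUnitor _ := HEq.rfl

theorem IsStrictMonoidal.comp {C : Type u₁} [Category.{v₁} C] [MonoidalCategory C]
    {D : Type u₂} [Category.{v₂} D] [MonoidalCategory D]
    {E : Type u₃} [Category.{v₃} E] [MonoidalCategory E] {F : C ⥤ D} {G : D ⥤ E}
    (hF : IsStrictMonoidal F) (hG : IsStrictMonoidal G) : IsStrictMonoidal (F ⋙ G) where
  obj_unit := (congrArg G.obj hF.obj_unit).trans hG.obj_unit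
  obj_tensor X Y := (congrArg G.obj (hF.obj_tensor X Y)).trans (hG.obj_tensor _ _)
  map_tensor f g :=
    (map_heq G (hF.obj_tensor _ _) (hF.obj_tensor _ _) (hF.map_tensor f g)).trans
      (hG.map_tensor _ _)
  map_associator X Y Z :=
    (map_heq G (by rw [hF.obj_tensor, hF.obj_tensor]) (by rw [hF.obj_tensor, hF.obj_tensor])
      (hF.map_associator X Y Z)).trans (hG.map_associator _ _ _)
  map_leftUnitor X :=
    (map_heq G (by rw [hF.obj_tensor, hF.obj_unit]) rfl (hF.map_leftUnitor X)).trans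
      (hG.map_leftUnitor _)
  map_rightUnitor X :=
    (map_heq G (by rw [hF.obj_tensor, hF.obj_unit]) rfl (hF.map_rightUnitor X)).trans
      (hG.map_rightUnitor _)

theorem IsStrictCartesian.id (C : Type u₁) [Category.{v₁} C] [CartesianMonoidalCategory C] :
    IsStrictCartesian (𝟭 C) where
  toIsStrictMonoidal := IsStrictMonoidal.id C
  map_diag _ := HEq.rfl
  map_toUnit _ := HEq.rfl

theorem IsStrictCartesian.comp {C : Type u₁} [Category.{v₁} C] [CartesianMonoidalCategory C]
    {D : Type u₂} [Category.{v₂} D] [CartesianMonoidalCategory D]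
    {E : Type u₃} [Category.{v₃} E] [CartesianMonoidalCategory E] {F : C ⥤ D} {G : D ⥤ E}
    (hF : IsStrictCartesian F) (hG : IsStrictCartesian G) : IsStrictCartesian (F ⋙ G) where
  toIsStrictMonoidal := hF.toIsStrictMonoidal.comp hG.toIsStrictMonoidal
  map_diag X :=
    (map_heq G rfl (hF.obj_tensor _ _) (hF.map_diag X)).trans (hG.map_diag _)
  map_toUnit X :=
    (map_heq G rfl hF.obj_unit (hF.map_toUnit X)).trans (hG.map_toUnit _)

theorem IsStrictCartesian.map_snd {C : Type u₁} [Category.{v₁} C] [CartesianMonoidalCategory C]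
    {D : Type u₂} [Category.{v₂} D] [CartesianMonoidalCategory D] {F : C ⥤ D}
    (hF : IsStrictCartesian F) (X Y : C) :
    HEq (F.map (snd X Y)) (snd (F.obj X) (F.obj Y)) := by
  have key : ∀ {a a' b b' : D} (_ : a = a') (_ : b = b') {f : F.obj X ⟶ a} {f' : F.obj X ⟶ a'}
      (_ : HEq f f') {p : a ⊗ F.obj Y ⟶ b} {p' : a' ⊗ F.obj Y ⟶ b'} (_ : HEq p p'),
      HEq ((f ⊗ₘ 𝟙 (F.obj Y)) ≫ p) ((f' ⊗ₘ 𝟙 (F.obj Y)) ≫ p') := by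
    intro a a' b b' ha hb f f' hf p p' hp
    subst ha hb; cases hf; cases hp; rfl
  have comp_heq : ∀ {a a' b b' c c' : D} (_ : a = a') (_ : b = b') (_ : c = c')
      {f : a ⟶ b} {f' : a' ⟶ b'} (_ : HEq f f') {g : b ⟶ c} {g' : b' ⟶ c'} (_ : HEq g g'),
      HEq (f ≫ g) (f' ≫ g') := by
    intro a a' b b' c c' ha hb hc f f' hf g g' hg
    subst ha hb hc; cases hf; cases hg; rfl
  have e1 : snd X Y = (toUnit X ⊗ₘ 𝟙 Y) ≫ (λ_ Y).hom := by
    rw [tensorHom_id]; exact snd_def X Y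
  have e2 : snd (F.obj X) (F.obj Y) =
      (toUnit (F.obj X) ⊗ₘ 𝟙 (F.obj Y)) ≫ (λ_ (F.obj Y)).hom := by
    rw [tensorHom_id]; exact snd_def _ _
  rw [e1, e2, F.map_comp]
  refine (comp_heq (hF.obj_tensor _ _) (hF.obj_tensor _ _) rfl (hF.map_tensor (toUnit X) (𝟙 Y))
    (g' := cast (by rw [hF.obj_tensor]) (F.map (λ_ Y).hom)) (cast_heq _ _).symm).trans ?_
  rw [F.map_id]
  exact key hF.obj_unit rfl (hF.map_toUnit X) ((cast_heq _ _).trans (hF.map_leftUnitor Y))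

/-! ### Elementary existential doctrines -/

section Doctrine

variable {C : Type u} [Category.{v} C]

/-- Reindexing `P_f : P(Y) → P(X)` along `f : X ⟶ Y`. -/
def reindex (P : Cᵒᵖ ⥤ SemilatInfCat.{w}) {X Y : C} (f : X ⟶ Y) (α : P.obj (op Y)) :
    P.obj (op X) :=
  P.map f.op α

open Classical in
/-- The left adjoint `∃_f : P(X) → P(Y)` of reindexing along `f : X ⟶ Y`. It is unique if it exists,
which is so wherever it is used below; where there is none, the value is arbitrary. -/
noncomputable def ex (P : Cᵒᵖ ⥤ SemilatInfCat.{w}) {X Y : C} (f : X ⟶ Y) :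
    P.obj (op X) → P.obj (op Y) :=
  if h : ∃ e : P.obj (op X) → P.obj (op Y), GaloisConnection e (reindex P f) then h.choose
  else fun _ => ⊤

theorem ex_gc (P : Cᵒᵖ ⥤ SemilatInfCat.{w}) {X Y : C} {f : X ⟶ Y}
    (h : ∃ e : P.obj (op X) → P.obj (op Y), GaloisConnection e (reindex P f)) :
    GaloisConnection (ex P f) (reindex P f) := by
  unfold ex
  rw [dif_pos h]
  exact h.choose_spec

variable [CartesianMonoidalCategory C]

/-- `P` is elementary with equality predicates `δ A ∈ P(A × A)`: for `e = id × Δ : X × A ⟶ X × A × A`,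
the assignment `α ↦ P_⟨π₁,π₂⟩(α) ∧ P_⟨π₂,π₃⟩(δ A)` is left adjoint to `P_e`. -/
def IsElementary (P : Cᵒᵖ ⥤ SemilatInfCat.{w}) (δ : ∀ A : C, P.obj (op (A ⊗ A))) : Prop :=
  ∀ X A : C, GaloisConnection
    (fun α : P.obj (op (X ⊗ A)) =>
      reindex P (X ◁ fst A A) α ⊓ reindex P (snd X (A ⊗ A)) (δ A))
    (reindex P (X ◁ diag A))

/-- `P` is existential: reindexings along projections have left adjoints, which satisfy the
Beck-Chevalley condition and Frobenius reciprocity. -/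
structure IsExistential (P : Cᵒᵖ ⥤ SemilatInfCat.{w}) : Prop where
  exists_fst (X A : C) : ∃ e : P.obj (op (X ⊗ A)) → P.obj (op X),
    GaloisConnection e (reindex P (fst X A))
  exists_snd (X A : C) : ∃ e : P.obj (op (X ⊗ A)) → P.obj (op A),
    GaloisConnection e (reindex P (snd X A))
  beckChevalley {X A X' A' : C} (f : A' ⟶ A) (f' : X' ⟶ X ⊗ A) (π' : X' ⟶ A')
    (_ : IsPullback π' f' f (snd X A)) (β : P.obj (op (X ⊗ A))) :
    ex P π' (reindex P f' β) = reindex P f (ex P (snd X A) β)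
  frobenius (X A : C) (α : P.obj (op A)) (β : P.obj (op (X ⊗ A))) :
    ex P (snd X A) (reindex P (snd X A) α ⊓ β) = α ⊓ ex P (snd X A) β

/-- The left adjoint along `⟨π₁, π₃⟩ : X × Y × Z ⟶ X × Z` exists. -/
theorem IsExistential.exists_middle {P : Cᵒᵖ ⥤ SemilatInfCat.{w}} (hP : IsExistential P)
    (X Y Z : C) : ∃ e : P.obj (op (X ⊗ (Y ⊗ Z))) → P.obj (op (X ⊗ Z)),
      GaloisConnection e (reindex P (X ◁ snd Y Z)) := by
  obtain ⟨e, he⟩ := hP.exists_snd Y (X ⊗ Z)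
  let s : Y ⊗ (X ⊗ Z) ⟶ X ⊗ (Y ⊗ Z) := lift (snd _ _ ≫ fst _ _) (Y ◁ snd X Z)
  let t : X ⊗ (Y ⊗ Z) ⟶ Y ⊗ (X ⊗ Z) := lift (snd _ _ ≫ fst _ _) (X ◁ snd Y Z)
  have hre : ∀ {U V W : C} (f : U ⟶ V) (g : V ⟶ W) (γ : P.obj (op W)),
      reindex P f (reindex P g γ) = reindex P (f ≫ g) γ := by
    intro U V W f g γ; simp [reindex]
  have hid : ∀ {U : C} (γ : P.obj (op U)), reindex P (𝟙 U) γ = γ := by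
    intro U γ; simp [reindex]
  have hmono : ∀ {U V : C} (f : U ⟶ V), Monotone (reindex P f) := by
    intro U V f a b hab
    exact OrderHomClass.mono (ConcreteCategory.hom (P.map f.op)) hab
  have hts : t ≫ s = 𝟙 _ := by
    ext <;> simp [s, t]
  have hst : s ≫ t = 𝟙 _ := by
    ext <;> simp [s, t]
  have htq : t ≫ snd _ _ = X ◁ snd Y Z := by simp [t]
  refine ⟨fun α => e (reindex P s α), fun α β => ?_⟩
  rw [he]
  constructor
  · intro h
    have := hmono t h
    rwa [hre, hre, hts, hid, htq] at this
  · intro h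
    have := hmono s h
    rwa [← htq, hre, ← Category.assoc, hst, Category.id_comp] at this

end Doctrine

/-- An elementary existential doctrine `P : Cᵒᵖ ⥤ InfSL` on a cartesian category `C`. The equality
predicates are uniquely determined, as `δ A = ∃_Δ(⊤)`. -/
structure EED : Type (max (u + 1) (v + 1) (w + 1)) where
  base : Type u
  [cat : Category.{v} base]
  [cart : CartesianMonoidalCategory base]
  fib : baseᵒᵖ ⥤ SemilatInfCat.{w}
  δ (A : base) : fib.obj (op (A ⊗ A))
  elementary : IsElementary fib δ
  existential : IsExistential fib

namespace EED

attribute [instance] EED.cat EED.cart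

/-- A morphism `(F, b)` of elementary existential doctrines. -/
structure Hom (P R : EED.{u, v, w}) : Type (max u v w) where
  F : P.base ⥤ R.base
  strict : IsStrictCartesian F
  b : P.fib ⟶ F.op ⋙ R.fib
  b_δ (A : P.base) : b.app (op (A ⊗ A)) (P.δ A) =
    reindex R.fib (eqToHom (strict.obj_tensor A A)) (R.δ (F.obj A))
  b_ex (X A : P.base) (α : P.fib.obj (op (X ⊗ A))) :
    b.app (op A) (ex P.fib (snd X A) α) =
      ex R.fib (F.map (snd X A)) (b.app (op (X ⊗ A)) α)

theorem Hom.ext' {P R : EED.{u, v, w}} {φ ψ : Hom P R} (hF : φ.F = ψ.F)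
    (hb : HEq φ.b ψ.b) : φ = ψ := by
  obtain ⟨F, _, b, _, _⟩ := φ
  obtain ⟨G, _, c, _, _⟩ := ψ
  dsimp only at hF hb
  subst hF
  cases hb
  rfl

/-- The identity morphism `(id, id)`. -/
def Hom.id (P : EED.{u, v, w}) : Hom P P where
  F := 𝟭 P.base
  strict := IsStrictCartesian.id _
  b := { app := fun X => 𝟙 (P.fib.obj X) }
  b_δ A := by simp [reindex]
  b_ex X A α := by simp

/-- The composite `(G F, c F ∘ b)` of `(F, b)` and `(G, c)`. -/
def Hom.comp {P R S : EED.{u, v, w}} (φ : Hom P R) (ψ : Hom R S) : Hom P S where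
  F := φ.F ⋙ ψ.F
  strict := φ.strict.comp ψ.strict
  b := { app := fun X => φ.b.app X ≫ ψ.b.app (op (φ.F.obj X.unop))
         naturality := fun X Y f => by
          have h1 := φ.b.naturality f
          have h2 := ψ.b.naturality (φ.F.map f.unop).op
          dsimp at h1 h2 ⊢
          rw [← Category.assoc, h1, Category.assoc, h2, Category.assoc] }
  b_δ A := by
    have h1 := φ.b_δ A
    have h2 := ψ.b_δ (φ.F.obj A)
    have h3 := ConcreteCategory.congr_hom
      (ψ.b.naturality (eqToHom (φ.strict.obj_tensor A A)).op) (R.δ (φ.F.obj A))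
    simp only [reindex, Functor.comp_obj, Functor.op_obj, Functor.comp_map, Functor.op_map,
      ConcreteCategory.comp_apply, Quiver.Hom.unop_op] at h1 h2 h3 ⊢
    rw [h1, h3, h2, ← ConcreteCategory.comp_apply, ← Functor.map_comp, ← op_comp, eqToHom_map,
      eqToHom_trans]
  b_ex X A α := by
    have key : ∀ (Z : R.base) (_ : Z = φ.F.obj X ⊗ φ.F.obj A) (p : Z ⟶ φ.F.obj A)
        (_ : HEq p (snd (φ.F.obj X) (φ.F.obj A))) (β : R.fib.obj (op Z)),
        ψ.b.app (op (φ.F.obj A)) (ex R.fib p β) =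
          ex S.fib (ψ.F.map p) (ψ.b.app (op Z) β) := by
      intro Z hZ p hp β
      subst hZ
      cases hp
      exact ψ.b_ex _ _ β
    have h1 := φ.b_ex X A α
    have h2 := key _ (φ.strict.obj_tensor X A) _ (φ.strict.map_snd X A)
      (φ.b.app (op (X ⊗ A)) α)
    simp only [ConcreteCategory.comp_apply]
    rw [h1]
    exact h2

instance : Category EED.{u, v, w} where
  Hom := Hom
  id := Hom.id
  comp := Hom.comp
  id_comp φ := Hom.ext' rfl (heq_of_eq (by ext X : 2; exact Category.id_comp _))
  comp_id φ := Hom.ext' rfl (heq_of_eq (by ext X : 2; exact Category.comp_id _))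
  assoc φ ψ χ := Hom.ext' rfl (heq_of_eq (by ext X : 2; exact Category.assoc _ _ _))

end EED

/-! ### Cartesian bicategories -/

/-- A cartesian bicategory (of relations). `CopyDiscardCategory` is Mathlib's notion of a symmetric
monoidal category with a chosen cocommutative comonoid `(Δ[X], ε[X])` on every object, coherent with
the monoidal structure. -/
structure CBC : Type (max (u + 1) (w + 1)) where
  carrier : Type u
  [cat : Category.{w} carrier]
  [mon : MonoidalCategory carrier]
  [copyDiscard : CopyDiscardCategory carrier]
  [order (X Y : carrier) : PartialOrder (X ⟶ Y)]
  comp_mono {X Y Z : carrier} {f f' : X ⟶ Y} {g g' : Y ⟶ Z} (_ : f ≤ f') (_ : g ≤ g') :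
    f ≫ g ≤ f' ≫ g'
  tensor_mono {X X' Y Y' : carrier} {f f' : X ⟶ X'} {g g' : Y ⟶ Y'} (_ : f ≤ f') (_ : g ≤ g') :
    f ⊗ₘ g ≤ f' ⊗ₘ g'
  /-- The right adjoint of `Δ[X]`. -/
  cocopy (X : carrier) : X ⊗ X ⟶ X
  /-- The right adjoint of `ε[X]`. -/
  codiscard (X : carrier) : 𝟙_ carrier ⟶ X
  unit_copy (X : carrier) : 𝟙 X ≤ Δ[X] ≫ cocopy X
  counit_copy (X : carrier) : cocopy X ≫ Δ[X] ≤ 𝟙 (X ⊗ X)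
  unit_discard (X : carrier) : 𝟙 X ≤ ε[X] ≫ codiscard X
  counit_discard (X : carrier) : codiscard X ≫ ε[X] ≤ 𝟙 (𝟙_ carrier)
  frobenius_left (X : carrier) :
    (Δ[X] ⊗ₘ 𝟙 X) ≫ (α_ X X X).hom ≫ (𝟙 X ⊗ₘ cocopy X) = cocopy X ≫ Δ[X]
  frobenius_right (X : carrier) :
    (𝟙 X ⊗ₘ Δ[X]) ≫ (α_ X X X).inv ≫ (cocopy X ⊗ₘ 𝟙 X) = cocopy X ≫ Δ[X]
  lax_copy {X Y : carrier} (R : X ⟶ Y) : R ≫ Δ[Y] ≤ Δ[X] ≫ (R ⊗ₘ R)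
  lax_discard {X Y : carrier} (R : X ⟶ Y) : R ≫ ε[Y] ≤ ε[X]

namespace CBC

attribute [instance] CBC.cat CBC.mon CBC.copyDiscard CBC.order

/-- A morphism of cartesian bicategories: a strict symmetric monoidal functor that preserves the
ordering, the chosen comonoids and the chosen monoids. -/
structure Hom (A B : CBC.{u, w}) : Type (max u w) where
  F : A.carrier ⥤ B.carrier
  strict : IsStrictMonoidal F
  map_braiding (X Y : A.carrier) : HEq (F.map (β_ X Y).hom) (β_ (F.obj X) (F.obj Y)).hom
  mono {X Y : A.carrier} {f g : X ⟶ Y} (_ : f ≤ g) : F.map f ≤ F.map g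
  map_copy (X : A.carrier) : HEq (F.map Δ[X]) Δ[F.obj X]
  map_discard (X : A.carrier) : HEq (F.map ε[X]) ε[F.obj X]
  map_cocopy (X : A.carrier) : HEq (F.map (A.cocopy X)) (B.cocopy (F.obj X))
  map_codiscard (X : A.carrier) : HEq (F.map (A.codiscard X)) (B.codiscard (F.obj X))

theorem Hom.ext' {A B : CBC.{u, w}} {φ ψ : Hom A B} (hF : φ.F = ψ.F) : φ = ψ := by
  cases φ; cases ψ; dsimp only at hF; subst hF; rfl

/-- The identity morphism. -/
def Hom.id (A : CBC.{u, w}) : Hom A A where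
  F := 𝟭 A.carrier
  strict := IsStrictMonoidal.id _
  map_braiding _ _ := HEq.rfl
  mono h := h
  map_copy _ := HEq.rfl
  map_discard _ := HEq.rfl
  map_cocopy _ := HEq.rfl
  map_codiscard _ := HEq.rfl

/-- Composition of morphisms is composition of functors. -/
def Hom.comp {A B D : CBC.{u, w}} (φ : Hom A B) (ψ : Hom B D) : Hom A D where
  F := φ.F ⋙ ψ.F
  strict := φ.strict.comp ψ.strict
  map_braiding X Y :=
    (map_heq ψ.F (φ.strict.obj_tensor _ _) (φ.strict.obj_tensor _ _) (φ.map_braiding X Y)).trans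
      (ψ.map_braiding _ _)
  mono h := ψ.mono (φ.mono h)
  map_copy X := (map_heq ψ.F rfl (φ.strict.obj_tensor _ _) (φ.map_copy X)).trans (ψ.map_copy _)
  map_discard X := (map_heq ψ.F rfl φ.strict.obj_unit (φ.map_discard X)).trans (ψ.map_discard _)
  map_cocopy X :=
    (map_heq ψ.F (φ.strict.obj_tensor _ _) rfl (φ.map_cocopy X)).trans (ψ.map_cocopy _)
  map_codiscard X :=
    (map_heq ψ.F φ.strict.obj_unit rfl (φ.map_codiscard X)).trans (ψ.map_codiscard _)

instance : Category CBC.{u, w} where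
  Hom := Hom
  id := Hom.id
  comp := Hom.comp
  id_comp _ := Hom.ext' rfl
  comp_id _ := Hom.ext' rfl
  assoc _ _ _ := Hom.ext' rfl

end CBC

/-! ### The data of a cartesian bicategory, without its laws -/

/-- The data that make up a cartesian bicategory, with none of the laws. -/
structure CBData : Type (max (u + 1) (w + 1)) where
  Obj : Type u
  Hom : Obj → Obj → Type w
  le {X Y : Obj} : Hom X Y → Hom X Y → Prop
  id (X : Obj) : Hom X X
  comp {X Y Z : Obj} : Hom X Y → Hom Y Z → Hom X Z
  tensorObj : Obj → Obj → Obj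
  tensorUnit : Obj
  tensorHom {X X' Y Y' : Obj} :
    Hom X X' → Hom Y Y' → Hom (tensorObj X Y) (tensorObj X' Y')
  associator (X Y Z : Obj) :
    Hom (tensorObj (tensorObj X Y) Z) (tensorObj X (tensorObj Y Z))
  leftUnitor (X : Obj) : Hom (tensorObj tensorUnit X) X
  rightUnitor (X : Obj) : Hom (tensorObj X tensorUnit) X
  braiding (X Y : Obj) : Hom (tensorObj X Y) (tensorObj Y X)
  copy (X : Obj) : Hom X (tensorObj X X)
  discard (X : Obj) : Hom X tensorUnit
  cocopy (X : Obj) : Hom (tensorObj X X) X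
  codiscard (X : Obj) : Hom tensorUnit X

/-- An action on objects and on morphisms, with none of the laws. -/
structure CBData.Map (D E : CBData.{u, w}) : Type (max u w) where
  obj : D.Obj → E.Obj
  map {X Y : D.Obj} : D.Hom X Y → E.Hom (obj X) (obj Y)

instance : Quiver CBData.{u, w} where
  Hom := CBData.Map

/-- The underlying data of cartesian bicategories and of their morphisms. -/
def CBC.toData : CBC.{u, w} ⥤q CBData.{u, w} where
  obj B :=
    { Obj := B.carrier
      Hom := fun X Y => X ⟶ Y
      le := fun f g => f ≤ g
      id := fun X => 𝟙 X
      comp := fun f g => f ≫ g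
      tensorObj := fun X Y => X ⊗ Y
      tensorUnit := 𝟙_ B.carrier
      tensorHom := fun f g => f ⊗ₘ g
      associator := fun X Y Z => (α_ X Y Z).hom
      leftUnitor := fun X => (λ_ X).hom
      rightUnitor := fun X => (ρ_ X).hom
      braiding := fun X Y => (β_ X Y).hom
      copy := fun X => Δ[X]
      discard := fun X => ε[X]
      cocopy := B.cocopy
      codiscard := B.codiscard }
  map φ := { obj := φ.F.obj, map := fun f => φ.F.map f }

/-! ### The relations of a doctrine -/

namespace EED

/-- The relations `X → Y` of `P`: the elements of `P(X × Y)`. -/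
abbrev Rel (P : EED.{u, v, w}) (X Y : P.base) : Type w := P.fib.obj (op (X ⊗ Y))

/-- Composition `∃_⟨π₁,π₃⟩(P_⟨π₁,π₂⟩ f ∧ P_⟨π₂,π₃⟩ g)` over `X × Y × Z`. -/
noncomputable def relComp (P : EED.{u, v, w}) {X Y Z : P.base} (f : P.Rel X Y) (g : P.Rel Y Z) :
    P.Rel X Z :=
  ex P.fib (X ◁ snd Y Z)
    (reindex P.fib (X ◁ fst Y Z) f ⊓ reindex P.fib (snd X (Y ⊗ Z)) g)

/-- Tensor `P_⟨π₁,π₃⟩ f ∧ P_⟨π₂,π₄⟩ g` over `A × C × B × D`. -/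
def relTensor (P : EED.{u, v, w}) {A B C D : P.base} (f : P.Rel A B) (g : P.Rel C D) :
    P.Rel (A ⊗ C) (B ⊗ D) :=
  reindex P.fib (fst A C ⊗ₘ fst B D) f ⊓ reindex P.fib (snd A C ⊗ₘ snd B D) g

/-- The graph `P_{f × id}(δ_Y)` of `f : X ⟶ Y`. -/
def graph (P : EED.{u, v, w}) {X Y : P.base} (f : X ⟶ Y) : P.Rel X Y :=
  reindex P.fib (f ▷ Y) (P.δ Y)

/-- The reverse graph `P_{id × f}(δ_Y)` of `f : X ⟶ Y`. -/
def cograph (P : EED.{u, v, w}) {X Y : P.base} (f : X ⟶ Y) : P.Rel Y X :=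
  reindex P.fib (Y ◁ f) (P.δ Y)

/-- The data of the cartesian bicategory of relations of `P`. The structural isomorphisms and the
comonoids are the graphs of those of the cartesian category `P.base`. -/
noncomputable def relData (P : EED.{u, v, w}) : CBData.{u, w} where
  Obj := P.base
  Hom X Y := P.Rel X Y
  le r s := r ≤ s
  id X := P.δ X
  comp f g := P.relComp f g
  tensorObj X Y := X ⊗ Y
  tensorUnit := 𝟙_ P.base
  tensorHom f g := P.relTensor f g
  associator X Y Z := P.graph (α_ X Y Z).hom
  leftUnitor X := P.graph (λ_ X).hom
  rightUnitor X := P.graph (ρ_ X).hom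
  braiding X Y := P.graph (lift (snd X Y) (fst X Y))
  copy X := P.graph (diag X)
  discard X := P.graph (toUnit X)
  cocopy X := P.cograph (diag X)
  codiscard X := P.cograph (toUnit X)

/-- The action `X ↦ F X`, `r ↦ b_{X × Y}(r)` of a morphism `(F, b)` of doctrines, where
`R(F(X × Y))` is identified with `R(F X × F Y)` along the equality `F(X × Y) = F X × F Y`. -/
def relMap {P R : EED.{u, v, w}} (φ : Hom P R) : CBData.Map P.relData R.relData where
  obj X := φ.F.obj X
  map {X Y} r :=
    reindex R.fib (eqToHom (φ.strict.obj_tensor X Y).symm) (φ.b.app (op (X ⊗ Y)) r)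

/-- The assignment of `relData` to doctrines and of `relMap` to their morphisms. -/
noncomputable def rel : EED.{u, v, w} ⥤q CBData.{u, w} where
  obj P := P.relData
  map φ := relMap φ

end EED

end DoctrineCB

namespace DoctrineCB

/-! ### Reindexing, uniqueness of left adjoints, and existential elimination -/

section Reindex

variable {C : Type u} [Category.{v} C] (P : Cᵒᵖ ⥤ SemilatInfCat.{w})

/-! The laws are proved in the internal regular logic of the doctrine, through generalised elements.
`Forces γ R x y` says that `γ ≤ P_⟨x,y⟩(R)` in a context `Γ`. Testing on the generic pair of
projections, with `R` itself as hypothesis, shows that a relation is determined by what forces it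
(`le_of_forces`, `eq_of_forces`).

The axioms become deduction rules. The unit and counit of the elementary adjunction give reflexivity
(`forces_refl`) and Leibniz substitution (`Forces.subst`), from which symmetry, congruence and
componentwise equality on products follow. The unit of `∃` gives the introduction rule for
composites (`relComp_intro`), while Beck–Chevalley, Frobenius and the adjunction give the
elimination rule (`Forces.elim`), which supplies a witness after enlarging the context. Composites
with a graph on the left or a cograph on the right need no quantifier (`forces_graph_comp`,
`forces_comp_cograph`).

Coherence laws that involve graphs only are then images of equations in the base category;
naturality, Frobenius and the lax laws are short deductions. For functoriality, a strict cartesian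
`F` preserves projections and pairings up to transport along object equalities, and `b` preserves
reindexing, meets, equality and `∃`. These are exactly the operations from which the relational
structure is built (`mapRel_graph`, `mapRel_comp`, `mapRel_tensor`). -/

@[simp]
theorem reindex_id {X : C} (α : P.obj (op X)) : reindex P (𝟙 X) α = α := by
  simp [reindex]

@[simp]
theorem reindex_reindex {X Y Z : C} (f : X ⟶ Y) (g : Y ⟶ Z) (α : P.obj (op Z)) :
    reindex P f (reindex P g α) = reindex P (f ≫ g) α := by
  simp [reindex]

@[simp]
theorem reindex_inf {X Y : C} (f : X ⟶ Y) (α β : P.obj (op Y)) :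
    reindex P f (α ⊓ β) = reindex P f α ⊓ reindex P f β :=
  map_inf (ConcreteCategory.hom (P.map f.op)) α β

@[simp]
theorem reindex_top {X Y : C} (f : X ⟶ Y) : reindex P f (⊤ : P.obj (op Y)) = ⊤ :=
  map_top (ConcreteCategory.hom (P.map f.op))

theorem reindex_mono {X Y : C} (f : X ⟶ Y) : Monotone (reindex P f) :=
  OrderHomClass.mono (ConcreteCategory.hom (P.map f.op))

/-- Left adjoints are unique, so the arbitrary choice in `ex` is harmless. -/
theorem ex_eq_of_gc {X Y : C} {f : X ⟶ Y} {e : P.obj (op X) → P.obj (op Y)}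
    (h : GaloisConnection e (reindex P f)) : ex P f = e :=
  funext fun _ => (ex_gc P ⟨e, h⟩).l_unique h fun _ => rfl

/-- The left adjoint along a morphism that is isomorphic to one with a left adjoint. -/
theorem gc_of_iso {X X' Y Y' : C} {p : X ⟶ Y} {e : P.obj (op X) → P.obj (op Y)}
    (h : GaloisConnection e (reindex P p)) (t : X' ≅ X) (s : Y ≅ Y') {q : X' ⟶ Y'}
    (hq : t.hom ≫ p ≫ s.hom = q) :
    GaloisConnection (fun α => reindex P s.inv (e (reindex P t.inv α))) (reindex P q) := by
  subst hq
  intro α β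
  trans e (reindex P t.inv α) ≤ reindex P s.hom β
  · exact ⟨fun H => by simpa using reindex_mono P s.hom H,
      fun H => by simpa using reindex_mono P s.inv H⟩
  · rw [h]
    exact ⟨fun H => by simpa using reindex_mono P t.hom H,
      fun H => by simpa using reindex_mono P t.inv H⟩

theorem ex_of_iso {X X' Y Y' : C} {p : X ⟶ Y}
    (h : ∃ e : P.obj (op X) → P.obj (op Y), GaloisConnection e (reindex P p)) (t : X' ≅ X)
    (s : Y ≅ Y') {q : X' ⟶ Y'} (hq : t.hom ≫ p ≫ s.hom = q) (α : P.obj (op X')) :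
    ex P q α = reindex P s.inv (ex P p (reindex P t.inv α)) := by
  rw [ex_eq_of_gc P (gc_of_iso P (ex_gc P h) t s hq)]

variable [CartesianMonoidalCategory C]

/-- Exchange of the first two factors of `X × Y × Z`. -/
def exchange (X Y Z : C) : X ⊗ (Y ⊗ Z) ≅ Y ⊗ (X ⊗ Z) where
  hom := lift (snd _ _ ≫ fst _ _) (X ◁ snd Y Z)
  inv := lift (snd _ _ ≫ fst _ _) (Y ◁ snd X Z)

variable {P}

/-- Beck–Chevalley and Frobenius are available only along `snd`; exchanging factors brings the
quantifier of relational composition to that form. -/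
theorem IsExistential.ex_middle (hP : IsExistential P) {X Y Z : C}
    (α : P.obj (op (X ⊗ (Y ⊗ Z)))) :
    ex P (X ◁ snd Y Z) α = ex P (snd Y (X ⊗ Z)) (reindex P (exchange X Y Z).inv α) := by
  rw [ex_of_iso P (hP.exists_snd _ _) (exchange X Y Z) (Iso.refl _) (by simp [exchange])]
  exact reindex_id P _

theorem isPullback_snd {A B : C} (Y : C) (c : B ⟶ A) :
    IsPullback (snd Y B) (Y ◁ c) c (snd Y A) where
  w := by simp
  isLimit' := ⟨Limits.PullbackCone.IsLimit.mk _
    (fun s => lift (s.snd ≫ fst _ _) s.fst)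
    (fun s => by simp)
    (fun s => by ext <;> simp [s.condition])
    (fun s m h₁ h₂ => by
      ext
      · simp [← h₂]
      · simpa using h₁)⟩

/-- Existential elimination: Beck–Chevalley moves the substitution `c` inside `∃`, Frobenius brings
`γ` under the quantifier, and the adjunction removes it. -/
theorem IsExistential.elim (hP : IsExistential P) {A B Y : C} {γ ψ : P.obj (op B)} {c : B ⟶ A}
    {β : P.obj (op (Y ⊗ A))} (h : γ ≤ reindex P c (ex P (snd Y A) β))
    (H : reindex P (snd Y B) γ ⊓ reindex P (Y ◁ c) β ≤ reindex P (snd Y B) ψ) : γ ≤ ψ := by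
  rw [← hP.beckChevalley c (Y ◁ c) (snd Y B) (isPullback_snd Y c) β] at h
  rw [← inf_eq_left.2 h, ← hP.frobenius]
  exact (ex_gc P (hP.exists_snd Y B) _ _).2 H

end Reindex

/-! ### Forcing with generalised elements -/

namespace EED

variable {P : EED.{u, v, w}}

/-- `γ ⊩ R(x, y)`: in the context `γ`, the relation `R` holds of the generalised elements `x`
and `y`. -/
def Forces {Γ X Y : P.base} (γ : P.fib.obj (op Γ)) (R : P.Rel X Y) (x : Γ ⟶ X) (y : Γ ⟶ Y) :
    Prop :=
  γ ≤ reindex P.fib (lift x y) R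

variable {Γ Γ' A B X Y Z X' Y' Z' : P.base} {γ : P.fib.obj (op Γ)}

theorem Forces.pull {R : P.Rel X Y} {x : Γ ⟶ X} {y : Γ ⟶ Y} (h : Forces γ R x y) {π : Γ' ⟶ Γ}
    {γ' : P.fib.obj (op Γ')} (hγ : γ' ≤ reindex P.fib π γ) : Forces γ' R (π ≫ x) (π ≫ y) := by
  have := hγ.trans (reindex_mono P.fib π h)
  rwa [reindex_reindex, comp_lift] at this

theorem Forces.mono {R S : P.Rel X Y} (hRS : R ≤ S) {x : Γ ⟶ X} {y : Γ ⟶ Y}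
    (h : Forces γ R x y) : Forces γ S x y :=
  h.trans (reindex_mono P.fib _ hRS)

/-- The generic case suffices: over `X × Y`, the context `R` forces `R` of the two projections. -/
theorem le_of_forces {R S : P.Rel X Y}
    (h : ∀ {Γ : P.base} (γ : P.fib.obj (op Γ)) (x : Γ ⟶ X) (y : Γ ⟶ Y),
      Forces γ R x y → Forces γ S x y) : R ≤ S := by
  simpa [Forces] using h R (fst X Y) (snd X Y) (by simp [Forces])

theorem eq_of_forces {R S : P.Rel X Y}
    (h : ∀ {Γ : P.base} (γ : P.fib.obj (op Γ)) (x : Γ ⟶ X) (y : Γ ⟶ Y),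
      Forces γ R x y ↔ Forces γ S x y) : R = S :=
  le_antisymm (le_of_forces fun γ x y => (h γ x y).1) (le_of_forces fun γ x y => (h γ x y).2)

theorem forces_reindex {f : X ⟶ X'} {g : Y ⟶ Y'} {R : P.Rel X' Y'} {x : Γ ⟶ X} {y : Γ ⟶ Y} :
    Forces γ (reindex P.fib (f ⊗ₘ g) R) x y ↔ Forces γ R (x ≫ f) (y ≫ g) := by
  simp [Forces]

theorem forces_inf {R S : P.Rel X Y} {x : Γ ⟶ X} {y : Γ ⟶ Y} :
    Forces γ (R ⊓ S) x y ↔ Forces γ R x y ∧ Forces γ S x y := by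
  simp [Forces]

@[simp]
theorem forces_graph {f : X ⟶ Y} {x : Γ ⟶ X} {y : Γ ⟶ Y} :
    Forces γ (P.graph f) x y ↔ Forces γ (P.δ Y) (x ≫ f) y := by
  simp [graph, Forces]

@[simp]
theorem forces_cograph {f : X ⟶ Y} {x : Γ ⟶ X} {y : Γ ⟶ Y} :
    Forces γ (P.cograph f) y x ↔ Forces γ (P.δ Y) y (x ≫ f) := by
  simp [cograph, Forces]

@[simp]
theorem forces_relTensor {R : P.Rel X Y} {S : P.Rel X' Y'} {x : Γ ⟶ X ⊗ X'} {y : Γ ⟶ Y ⊗ Y'} :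
    Forces γ (P.relTensor R S) x y ↔
      Forces γ R (x ≫ fst _ _) (y ≫ fst _ _) ∧ Forces γ S (x ≫ snd _ _) (y ≫ snd _ _) := by
  rw [relTensor, forces_inf, forces_reindex, forces_reindex]

/-! ### Equality -/

/-- The unit of the elementary adjunction at `⊤`, pulled back along `⟨a, a⟩`. -/
theorem forces_refl (γ : P.fib.obj (op Γ)) (a : Γ ⟶ A) : Forces γ (P.δ A) a a := by
  have h := (P.elementary A A ⊤ _).1 le_rfl
  have h := reindex_mono P.fib (lift a a) h
  simp only [reindex_top, reindex_reindex, top_inf_eq] at h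
  refine le_top.trans (h.trans_eq ?_)
  congr 1
  ext <;> simp

/-- Leibniz's rule is the counit of the elementary adjunction at the predicate `R(x, b)` on `X × A ×
A`, whose restriction to the diagonal is `R`. -/
theorem Forces.subst {R : P.Rel X A} {x : Γ ⟶ X} {a b : Γ ⟶ A} (h : Forces γ R x a)
    (hab : Forces γ (P.δ A) a b) : Forces γ R x b := by
  have key := (P.elementary X A).l_u_le (reindex P.fib (X ◁ snd A A) R)
  have key := reindex_mono P.fib (lift x (lift a b)) key
  simp only [reindex_inf, reindex_reindex, ← whiskerLeft_comp, lift_whiskerLeft, lift_snd,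
    lift_fst, Category.comp_id, MonoidalCategory.whiskerLeft_id] at key
  exact (le_inf h hab).trans key

theorem Forces.eq_symm {a b : Γ ⟶ A} (h : Forces γ (P.δ A) a b) : Forces γ (P.δ A) b a := by
  have := Forces.subst (R := reindex P.fib (lift (snd A A) (fst A A)) (P.δ A)) (x := a) (a := a)
    (b := b) (by simpa [Forces] using forces_refl γ a) h
  simpa [Forces] using this

theorem Forces.subst_left {R : P.Rel A X} {x : Γ ⟶ X} {a b : Γ ⟶ A} (h : Forces γ R a x)
    (hab : Forces γ (P.δ A) a b) : Forces γ R b x := by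
  have := Forces.subst (R := reindex P.fib (lift (snd X A) (fst X A)) R) (x := x) (a := a)
    (b := b) (by simpa [Forces] using h) hab
  simpa [Forces] using this

theorem Forces.eq_comp {a b : Γ ⟶ A} (h : Forces γ (P.δ A) a b) (f : A ⟶ B) :
    Forces γ (P.δ B) (a ≫ f) (b ≫ f) := by
  have := Forces.subst (R := P.cograph f) (x := a ≫ f) (a := a) (b := b)
    (forces_cograph.2 (forces_refl _ _)) h
  exact forces_cograph.1 this

/-- Congruence gives one direction; for the other, the coordinates of `a` are replaced by those of
`b` one at a time. -/
theorem forces_δ_tensor {a b : Γ ⟶ A ⊗ B} :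
    Forces γ (P.δ (A ⊗ B)) a b ↔
      Forces γ (P.δ A) (a ≫ fst _ _) (b ≫ fst _ _) ∧
        Forces γ (P.δ B) (a ≫ snd _ _) (b ≫ snd _ _) := by
  refine ⟨fun h => ⟨h.eq_comp _, h.eq_comp _⟩, fun ⟨h₁, h₂⟩ => ?_⟩
  have h₃ : Forces γ (P.δ (A ⊗ B)) a (lift (b ≫ fst _ _) (a ≫ snd _ _)) := by
    have := Forces.subst (x := a)
      (R := reindex P.fib (lift (fst _ _) (lift (snd _ _) (fst (A ⊗ B) A ≫ snd A B)))
        (P.δ (A ⊗ B))) (by simpa [Forces] using forces_refl γ a) h₁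
    simpa [Forces] using this
  -- The predicate here is `a = (b₁, t)`. It depends on both `a` and `b`, which are therefore packed
  -- into a single parameter.
  have := Forces.subst (x := lift a b)
    (R := reindex P.fib (lift (fst ((A ⊗ B) ⊗ (A ⊗ B)) B ≫ fst _ _)
      (lift (fst ((A ⊗ B) ⊗ (A ⊗ B)) B ≫ snd _ _ ≫ fst _ _) (snd _ _)))
        (P.δ (A ⊗ B))) (a := a ≫ snd _ _) (by simpa [Forces] using h₃) h₂
  simpa [Forces] using this

theorem forces_δ_unit {a b : Γ ⟶ 𝟙_ P.base} : Forces γ (P.δ (𝟙_ P.base)) a b := by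
  rw [toUnit_unique a b]
  exact forces_refl γ b

/-! ### Composition -/

theorem relComp_intro {R : P.Rel X Y} {S : P.Rel Y Z} {x : Γ ⟶ X} {z : Γ ⟶ Z} (y : Γ ⟶ Y)
    (h₁ : Forces γ R x y) (h₂ : Forces γ S y z) : Forces γ (P.relComp R S) x z := by
  have h := (ex_gc P.fib (P.existential.exists_middle X Y Z)).le_u_l
    (reindex P.fib (X ◁ fst Y Z) R ⊓ reindex P.fib (snd X (Y ⊗ Z)) S)
  have h := reindex_mono P.fib (lift x (lift y z)) h
  simp only [reindex_inf, reindex_reindex, lift_whiskerLeft, lift_snd, lift_fst] at h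
  exact (le_inf h₁ h₂).trans h

/-- The witness is the projection to `Y` from the larger context `Y × Γ`. Quantifying `H` over all
contexts above `γ` hides this choice and lets eliminations be nested. -/
theorem Forces.elim {R : P.Rel X Y} {S : P.Rel Y Z} {x : Γ ⟶ X} {z : Γ ⟶ Z}
    (h : Forces γ (P.relComp R S) x z) {T : P.Rel A B} {a : Γ ⟶ A} {b : Γ ⟶ B}
    (H : ∀ {Γ' : P.base} {γ' : P.fib.obj (op Γ')} {π : Γ' ⟶ Γ} (y : Γ' ⟶ Y),
      γ' ≤ reindex P.fib π γ → Forces γ' R (π ≫ x) y → Forces γ' S y (π ≫ z) →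
        Forces γ' T (π ≫ a) (π ≫ b)) : Forces γ T a b := by
  rw [Forces, relComp, P.existential.ex_middle] at h
  refine P.existential.elim h ?_
  rw [reindex_reindex, reindex_reindex, comp_lift]
  refine H (fst _ _) inf_le_left (inf_le_right.trans ?_) (inf_le_right.trans ?_)
  · rw [reindex_inf, reindex_reindex, reindex_reindex]
    refine inf_le_left.trans (le_of_eq ?_)
    congr 1
    ext <;> simp [exchange]
  · rw [reindex_inf, reindex_reindex, reindex_reindex]
    refine inf_le_right.trans (le_of_eq ?_)
    congr 1
    ext <;> simp [exchange]

/-- One-point rule: the intermediate element must equal `x ≫ f`, so the quantifier disappears. -/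
theorem forces_graph_comp {f : X ⟶ Y} {R : P.Rel Y Z} {x : Γ ⟶ X} {z : Γ ⟶ Z} :
    Forces γ (P.relComp (P.graph f) R) x z ↔ Forces γ R (x ≫ f) z := by
  refine ⟨fun h => h.elim fun y _ h₁ h₂ => ?_, fun h => relComp_intro (x ≫ f) ?_ h⟩
  · rw [forces_graph, Category.assoc] at h₁
    exact h₂.subst_left h₁.eq_symm
  · exact forces_graph.2 (forces_refl _ _)

theorem forces_comp_cograph {f : X ⟶ Y} {R : P.Rel Z Y} {x : Γ ⟶ X} {z : Γ ⟶ Z} :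
    Forces γ (P.relComp R (P.cograph f)) z x ↔ Forces γ R z (x ≫ f) := by
  refine ⟨fun h => h.elim fun y _ h₁ h₂ => ?_, fun h => relComp_intro (x ≫ f) h ?_⟩
  · rw [forces_cograph, Category.assoc] at h₂
    exact h₁.subst h₂
  · exact forces_cograph.2 (forces_refl _ _)

theorem graph_id (X : P.base) : P.graph (𝟙 X) = P.δ X := by
  simp [graph]

theorem cograph_id (X : P.base) : P.cograph (𝟙 X) = P.δ X := by
  simp [cograph]

theorem graph_comp (f : X ⟶ Y) (g : Y ⟶ Z) :
    P.graph (f ≫ g) = P.relComp (P.graph f) (P.graph g) :=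
  eq_of_forces fun γ x y => by rw [forces_graph_comp]; simp

theorem graph_tensor (f : X ⟶ X') (g : Y ⟶ Y') :
    P.graph (f ⊗ₘ g) = P.relTensor (P.graph f) (P.graph g) :=
  eq_of_forces fun γ x y => by simp [forces_δ_tensor]

theorem cograph_tensor (f : X ⟶ X') (g : Y ⟶ Y') :
    P.cograph (f ⊗ₘ g) = P.relTensor (P.cograph f) (P.cograph g) :=
  eq_of_forces fun γ x y => by simp [forces_δ_tensor]

theorem graph_iso_hom (f : X ≅ Y) : P.graph f.hom = P.cograph f.inv :=
  eq_of_forces fun γ x y => by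
    rw [forces_graph, forces_cograph]
    exact ⟨fun h => by simpa using h.eq_comp f.inv, fun h => by simpa using h.eq_comp f.hom⟩

theorem forces_comp_graph_iso_hom {f : Y ≅ X} {R : P.Rel Z Y} {x : Γ ⟶ X} {z : Γ ⟶ Z} :
    Forces γ (P.relComp R (P.graph f.hom)) z x ↔ Forces γ R z (x ≫ f.inv) := by
  rw [graph_iso_hom, forces_comp_cograph]

theorem δ_comp (R : P.Rel X Y) : P.relComp (P.δ X) R = R :=
  eq_of_forces fun γ x y => by rw [← graph_id, forces_graph_comp, Category.comp_id]

theorem comp_δ (R : P.Rel X Y) : P.relComp R (P.δ Y) = R :=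
  eq_of_forces fun γ x y => by rw [← cograph_id, forces_comp_cograph, Category.comp_id]

theorem relComp_assoc {W : P.base} (R : P.Rel W X) (S : P.Rel X Y) (T : P.Rel Y Z) :
    P.relComp (P.relComp R S) T = P.relComp R (P.relComp S T) := by
  refine eq_of_forces fun γ w z => ⟨fun h => ?_, fun h => ?_⟩
  · refine h.elim fun y _ h₁ hT => h₁.elim fun x hγ hR hS => ?_
    exact relComp_intro x hR (relComp_intro _ hS (hT.pull hγ))
  · refine h.elim fun x _ hR h₁ => h₁.elim fun y hγ hS hT => ?_
    exact relComp_intro y (relComp_intro _ (hR.pull hγ) hS) hT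

theorem relComp_mono {R R' : P.Rel X Y} {S S' : P.Rel Y Z} (hR : R ≤ R') (hS : S ≤ S') :
    P.relComp R S ≤ P.relComp R' S' :=
  le_of_forces fun _ _ _ h => h.elim fun y _ h₁ h₂ => relComp_intro y (h₁.mono hR) (h₂.mono hS)

theorem relTensor_mono {R R' : P.Rel X Y} {S S' : P.Rel X' Y'} (hR : R ≤ R') (hS : S ≤ S') :
    P.relTensor R S ≤ P.relTensor R' S' :=
  inf_le_inf (reindex_mono _ _ hR) (reindex_mono _ _ hS)

theorem relTensor_comp (R : P.Rel X Y) (R' : P.Rel X' Y') (S : P.Rel Y Z) (S' : P.Rel Y' Z') :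
    P.relComp (P.relTensor R R') (P.relTensor S S') =
      P.relTensor (P.relComp R S) (P.relComp R' S') := by
  refine eq_of_forces fun γ x z => ⟨fun h => ?_, fun h => ?_⟩
  · refine h.elim fun y _ h₁ h₂ => ?_
    simp only [forces_relTensor, Category.assoc] at h₁ h₂ ⊢
    exact ⟨relComp_intro _ h₁.1 h₂.1, relComp_intro _ h₁.2 h₂.2⟩
  · obtain ⟨h₁, h₂⟩ := forces_relTensor.1 h
    -- The second witness lives over the context already extended by `y`, so `y` and its properties
    -- are pulled back along `π` before pairing.
    refine h₁.elim fun y _ hR hS => (h₂.pull ‹_›).elim fun {_ _ π} y' hγ hR' hS' => ?_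
    have hR := hR.pull hγ
    have hS := hS.pull hγ
    refine relComp_intro (lift (π ≫ y) y') ?_ ?_
    · simpa using ⟨hR, hR'⟩
    · simpa using ⟨hS, hS'⟩

/-! ### The laws of a cartesian bicategory -/

theorem graph_whiskerRight {X Y : P.base} (f : X ⟶ Y) (Z : P.base) :
    P.graph (f ▷ Z) = P.relTensor (P.graph f) (P.δ Z) := by
  rw [← graph_id, ← graph_tensor, tensorHom_id]

theorem graph_whiskerLeft {X Y : P.base} (f : X ⟶ Y) (Z : P.base) :
    P.graph (Z ◁ f) = P.relTensor (P.δ Z) (P.graph f) := by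
  rw [← graph_id, ← graph_tensor, id_tensorHom]

theorem relTensor_id (X Y : P.base) : P.relTensor (P.δ X) (P.δ Y) = P.δ (X ⊗ Y) := by
  rw [← graph_id, ← graph_whiskerRight, id_whiskerRight, graph_id]

/-- Reduces naturality to a quantifier-free statement. Invertibility of `g` makes its graph a
cograph, so the one-point rule applies on the right too. -/
theorem comp_graph_eq_graph_comp {W X Y Z : P.base} {R : P.Rel X Y} {S : P.Rel W Z} {f : W ⟶ X}
    {g : Z ≅ Y} (h : ∀ {Γ : P.base} (γ : P.fib.obj (op Γ)) (x : Γ ⟶ W) (y : Γ ⟶ Y),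
        Forces γ S x (y ≫ g.inv) ↔ Forces γ R (x ≫ f) y) :
    P.relComp S (P.graph g.hom) = P.relComp (P.graph f) R :=
  eq_of_forces fun γ x y => by rw [forces_comp_graph_iso_hom, forces_graph_comp, h]

theorem relTensor_associator {X₁ X₂ X₃ Y₁ Y₂ Y₃ : P.base} (R₁ : P.Rel X₁ Y₁) (R₂ : P.Rel X₂ Y₂)
    (R₃ : P.Rel X₃ Y₃) :
    P.relComp (P.relTensor (P.relTensor R₁ R₂) R₃) (P.graph (α_ Y₁ Y₂ Y₃).hom) =
      P.relComp (P.graph (α_ X₁ X₂ X₃).hom) (P.relTensor R₁ (P.relTensor R₂ R₃)) :=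
  comp_graph_eq_graph_comp fun γ x y => by simp [and_assoc]

theorem relTensor_leftUnitor {X Y : P.base} (R : P.Rel X Y) :
    P.relComp (P.relTensor (P.δ (𝟙_ P.base)) R) (P.graph (λ_ Y).hom) =
      P.relComp (P.graph (λ_ X).hom) R :=
  comp_graph_eq_graph_comp fun γ x y => by simp [leftUnitor_hom, forces_δ_unit]

theorem relTensor_rightUnitor {X Y : P.base} (R : P.Rel X Y) :
    P.relComp (P.relTensor R (P.δ (𝟙_ P.base))) (P.graph (ρ_ Y).hom) =
      P.relComp (P.graph (ρ_ X).hom) R :=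
  comp_graph_eq_graph_comp fun γ x y => by simp [rightUnitor_hom, forces_δ_unit]

/-- The symmetry of a cartesian category. -/
def swapIso (X Y : P.base) : X ⊗ Y ≅ Y ⊗ X where
  hom := lift (snd X Y) (fst X Y)
  inv := lift (snd Y X) (fst Y X)

theorem relTensor_swap {X X' Y Y' : P.base} (R : P.Rel X X') (S : P.Rel Y Y') :
    P.relComp (P.relTensor R S) (P.graph (swapIso X' Y').hom) =
      P.relComp (P.graph (swapIso X Y).hom) (P.relTensor S R) :=
  comp_graph_eq_graph_comp fun γ x y => by simp [swapIso, and_comm]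

theorem graph_pentagon (W X Y Z : P.base) :
    P.relComp (P.relTensor (P.graph (α_ W X Y).hom) (P.δ Z))
        (P.relComp (P.graph (α_ W (X ⊗ Y) Z).hom)
          (P.relTensor (P.δ W) (P.graph (α_ X Y Z).hom))) =
      P.relComp (P.graph (α_ (W ⊗ X) Y Z).hom) (P.graph (α_ W X (Y ⊗ Z)).hom) := by
  simp only [← graph_whiskerLeft, ← graph_whiskerRight, ← graph_comp, pentagon]

theorem graph_triangle (X Y : P.base) :
    P.relComp (P.graph (α_ X (𝟙_ P.base) Y).hom) (P.relTensor (P.δ X) (P.graph (λ_ Y).hom)) =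
      P.relTensor (P.graph (ρ_ X).hom) (P.δ Y) := by
  simp only [← graph_whiskerLeft, ← graph_whiskerRight, ← graph_comp, triangle]

theorem graph_hexagon_forward (X Y Z : P.base) :
    P.relComp (P.graph (α_ X Y Z).hom)
        (P.relComp (P.graph (swapIso X (Y ⊗ Z)).hom) (P.graph (α_ Y Z X).hom)) =
      P.relComp (P.relTensor (P.graph (swapIso X Y).hom) (P.δ Z))
        (P.relComp (P.graph (α_ Y X Z).hom)
          (P.relTensor (P.δ Y) (P.graph (swapIso X Z).hom))) := by
  simp only [← graph_whiskerLeft, ← graph_whiskerRight, ← graph_comp]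
  congr 1
  ext <;> simp [swapIso]

theorem graph_hexagon_reverse (X Y Z : P.base) :
    P.relComp (P.graph (α_ X Y Z).inv)
        (P.relComp (P.graph (swapIso (X ⊗ Y) Z).hom) (P.graph (α_ Z X Y).inv)) =
      P.relComp (P.relTensor (P.δ X) (P.graph (swapIso Y Z).hom))
        (P.relComp (P.graph (α_ X Z Y).inv)
          (P.relTensor (P.graph (swapIso X Z).hom) (P.δ Y))) := by
  simp only [← graph_whiskerLeft, ← graph_whiskerRight, ← graph_comp]
  congr 1
  ext <;> simp [swapIso]

theorem graph_counit_comul (X : P.base) :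
    P.relComp (P.graph (diag X)) (P.relTensor (P.graph (toUnit X)) (P.δ X)) =
      P.graph (λ_ X).inv := by
  simp only [← graph_whiskerRight, ← graph_comp]
  congr 1
  ext
  simp

theorem graph_comul_counit (X : P.base) :
    P.relComp (P.graph (diag X)) (P.relTensor (P.δ X) (P.graph (toUnit X))) =
      P.graph (ρ_ X).inv := by
  simp only [← graph_whiskerLeft, ← graph_comp]
  congr 1
  ext
  simp

theorem graph_comul_assoc (X : P.base) :
    P.relComp (P.graph (diag X)) (P.relTensor (P.δ X) (P.graph (diag X))) =
      P.relComp (P.graph (diag X))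
        (P.relComp (P.relTensor (P.graph (diag X)) (P.δ X)) (P.graph (α_ X X X).hom)) := by
  simp only [← graph_whiskerLeft, ← graph_whiskerRight, ← graph_comp]
  congr 1
  ext <;> simp

theorem graph_comul_comm (X : P.base) :
    P.relComp (P.graph (diag X)) (P.graph (swapIso X X).hom) = P.graph (diag X) := by
  rw [← graph_comp]
  congr 1
  ext <;> simp [swapIso]

theorem graph_copy_tensor (X Y : P.base) :
    P.graph (diag (X ⊗ Y)) =
      P.relComp (P.relTensor (P.graph (diag X)) (P.graph (diag Y)))
        (P.relComp (P.graph (α_ X X (Y ⊗ Y)).hom)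
          (P.relComp (P.relTensor (P.δ X) (P.graph (α_ X Y Y).inv))
            (P.relComp (P.relTensor (P.δ X) (P.relTensor (P.graph (swapIso X Y).hom) (P.δ Y)))
              (P.relComp (P.relTensor (P.δ X) (P.graph (α_ Y X Y).hom))
                (P.graph (α_ X Y (X ⊗ Y)).inv))))) := by
  simp only [← graph_whiskerLeft, ← graph_whiskerRight, ← graph_comp, ← graph_tensor]
  congr 1
  ext <;> simp [swapIso]

theorem graph_discard_tensor (X Y : P.base) :
    P.graph (toUnit (X ⊗ Y)) =
      P.relComp (P.relTensor (P.graph (toUnit X)) (P.graph (toUnit Y)))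
        (P.graph (λ_ (𝟙_ P.base)).hom) := by
  rw [← graph_tensor, ← graph_comp]
  congr 1
  exact toUnit_unique _ _

/-- Congruence of equality under `f`; with `counit_graph`, every graph is left adjoint to its
cograph. -/
theorem unit_graph {X Y : P.base} (f : X ⟶ Y) : P.δ X ≤ P.relComp (P.graph f) (P.cograph f) :=
  le_of_forces fun γ x y h => by
    rw [forces_graph_comp, forces_cograph]
    exact h.eq_comp f

theorem counit_graph {X Y : P.base} (f : X ⟶ Y) : P.relComp (P.cograph f) (P.graph f) ≤ P.δ Y :=
  le_of_forces fun γ x y h => h.elim fun z _ h₁ h₂ => by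
    rw [forces_cograph] at h₁
    rw [forces_graph] at h₂
    exact h₁.subst h₂

/-- A common normal form for the Frobenius laws: all coordinates of `x` and `y` are equal. -/
theorem forces_cograph_diag_comp_graph_diag {Γ X : P.base} {γ : P.fib.obj (op Γ)}
    {x y : Γ ⟶ X ⊗ X} :
    Forces γ (P.relComp (P.cograph (diag X)) (P.graph (diag X))) x y ↔
      Forces γ (P.δ X) (x ≫ fst _ _) (y ≫ fst _ _) ∧
      Forces γ (P.δ X) (x ≫ fst _ _) (y ≫ snd _ _) ∧
      Forces γ (P.δ X) (x ≫ snd _ _) (y ≫ fst _ _) ∧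
      Forces γ (P.δ X) (x ≫ snd _ _) (y ≫ snd _ _) := by
  refine ⟨fun h => ⟨?_, ?_, ?_, ?_⟩, fun ⟨h₁, h₂, h₃, h₄⟩ => relComp_intro (x ≫ fst _ _) ?_ ?_⟩
  iterate 4
    refine h.elim fun z _ h₁ h₂ => ?_
    simp only [forces_cograph, forces_graph, forces_δ_tensor, Category.assoc, lift_fst, lift_snd,
      Category.comp_id] at h₁ h₂
    first
      | exact h₁.1.subst h₂.1
      | exact h₁.1.subst h₂.2
      | exact h₁.2.subst h₂.1
      | exact h₁.2.subst h₂.2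
  · simpa [forces_δ_tensor, forces_refl] using h₃.subst h₁.eq_symm
  · simpa [forces_δ_tensor] using ⟨h₁, h₂⟩

theorem frobenius_left (X : P.base) :
    P.relComp (P.relTensor (P.graph (diag X)) (P.δ X))
        (P.relComp (P.graph (α_ X X X).hom) (P.relTensor (P.δ X) (P.cograph (diag X)))) =
      P.relComp (P.cograph (diag X)) (P.graph (diag X)) := by
  rw [← graph_whiskerRight, ← relComp_assoc, ← graph_comp, ← cograph_id, ← cograph_tensor]
  refine eq_of_forces fun γ x y => ?_
  rw [forces_comp_cograph, forces_graph, forces_cograph_diag_comp_graph_diag]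
  simp only [forces_δ_tensor, Category.assoc, tensorHom_fst, tensorHom_snd, whiskerRight_snd,
    associator_hom_fst, associator_hom_snd_fst, associator_hom_snd_snd,
    whiskerRight_fst_assoc, lift_fst, lift_snd, Category.comp_id]
  -- The left side gives only `x₁ = y₁`, `x₁ = y₂`, `x₂ = y₂`; the fourth equation is `x₂ = y₂ = x₁
  -- = y₁`.
  exact ⟨fun ⟨h₁, h₂, h₃⟩ => ⟨h₁, h₂, (h₃.subst h₂.eq_symm).subst h₁, h₃⟩,
    fun ⟨h₁, h₂, _, h₃⟩ => ⟨h₁, h₂, h₃⟩⟩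

theorem frobenius_right (X : P.base) :
    P.relComp (P.relTensor (P.δ X) (P.graph (diag X)))
        (P.relComp (P.graph (α_ X X X).inv) (P.relTensor (P.cograph (diag X)) (P.δ X))) =
      P.relComp (P.cograph (diag X)) (P.graph (diag X)) := by
  rw [← graph_whiskerLeft, ← relComp_assoc, ← graph_comp, ← cograph_id, ← cograph_tensor]
  refine eq_of_forces fun γ x y => ?_
  rw [forces_comp_cograph, forces_graph, forces_cograph_diag_comp_graph_diag]
  simp only [forces_δ_tensor, Category.assoc, tensorHom_fst, tensorHom_snd, whiskerLeft_fst,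
    associator_inv_fst_fst, associator_inv_fst_snd, associator_inv_snd,
    whiskerLeft_snd_assoc, lift_fst, lift_snd, Category.comp_id]
  exact ⟨fun ⟨⟨h₁, h₂⟩, h₃⟩ => ⟨h₁, (h₁.subst h₂.eq_symm).subst h₃, h₂, h₃⟩,
    fun ⟨h₁, _, h₂, h₃⟩ => ⟨⟨h₁, h₂⟩, h₃⟩⟩

theorem lax_copy {X Y : P.base} (R : P.Rel X Y) :
    P.relComp R (P.graph (diag Y)) ≤ P.relComp (P.graph (diag X)) (P.relTensor R R) := by
  refine le_of_forces fun γ x y h => h.elim fun z _ h₁ h₂ => ?_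
  rw [forces_graph, forces_δ_tensor] at h₂
  rw [forces_graph_comp, forces_relTensor]
  simp only [Category.assoc, lift_fst, lift_snd, Category.comp_id] at h₂ ⊢
  exact ⟨h₁.subst h₂.1, h₁.subst h₂.2⟩

theorem lax_discard {X Y : P.base} (R : P.Rel X Y) :
    P.relComp R (P.graph (toUnit Y)) ≤ P.graph (toUnit X) :=
  le_of_forces fun _ _ _ _ => forces_graph.2 forces_δ_unit

/-! ### The cartesian bicategory of relations -/

/-- The objects of `P.base`, as objects of the bicategory of relations of `P`. -/
def RelObj (P : EED.{u, v, w}) : Type u := P.base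

/-- The synonym `RelObj` keeps this structure apart from that of `P.base`; laws stated over `P.base`
apply by unfolding. -/
noncomputable instance : Category.{w} P.RelObj where
  Hom X Y := P.Rel X Y
  id X := P.δ X
  comp R S := P.relComp R S
  id_comp R := δ_comp R
  comp_id R := comp_δ R
  assoc R S T := relComp_assoc R S T

/-- The isomorphism of relations given by the graphs of an isomorphism. -/
noncomputable def graphIso {X Y : P.base} (f : X ≅ Y) :
    @Iso P.RelObj _ X Y where
  hom := P.graph f.hom
  inv := P.graph f.inv
  hom_inv_id := (graph_comp f.hom f.inv).symm.trans (by rw [f.hom_inv_id, graph_id]; rfl)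
  inv_hom_id := (graph_comp f.inv f.hom).symm.trans (by rw [f.inv_hom_id, graph_id]; rfl)

noncomputable instance : MonoidalCategoryStruct P.RelObj where
  tensorObj X Y := tensorObj (C := P.base) X Y
  tensorUnit := 𝟙_ P.base
  tensorHom R S := P.relTensor R S
  whiskerLeft X _ _ R := P.relTensor (P.δ X) R
  whiskerRight R X := P.relTensor R (P.δ X)
  associator X Y Z := graphIso (associator (C := P.base) X Y Z)
  leftUnitor X := graphIso (leftUnitor (C := P.base) X)
  rightUnitor X := graphIso (rightUnitor (C := P.base) X)

noncomputable instance : MonoidalCategory P.RelObj :=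
  .ofTensorHom
    (id_tensorHom_id := relTensor_id (P := P))
    (id_tensorHom := fun _ _ _ _ => rfl)
    (tensorHom_id := fun _ _ => rfl)
    (tensorHom_comp_tensorHom := relTensor_comp (P := P))
    (associator_naturality := relTensor_associator (P := P))
    (leftUnitor_naturality := relTensor_leftUnitor (P := P))
    (rightUnitor_naturality := relTensor_rightUnitor (P := P))
    (pentagon := graph_pentagon (P := P))
    (triangle := graph_triangle (P := P))

noncomputable instance : SymmetricCategory P.RelObj where
  braiding X Y := graphIso (swapIso (P := P) X Y)
  braiding_naturality_right X _ _ R := relTensor_swap (P.δ X) R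
  braiding_naturality_left R Z := relTensor_swap R (P.δ Z)
  hexagon_forward := graph_hexagon_forward (P := P)
  hexagon_reverse := graph_hexagon_reverse (P := P)
  symmetry X Y := (graphIso (swapIso (P := P) X Y)).hom_inv_id

noncomputable instance (X : P.RelObj) : ComonObj X where
  counit := P.graph (toUnit (C := P.base) X)
  comul := P.graph (diag (C := P.base) X)
  counit_comul := graph_counit_comul (P := P) X
  comul_counit := graph_comul_counit (P := P) X
  comul_assoc := graph_comul_assoc (P := P) X

noncomputable instance : CopyDiscardCategory P.RelObj where
  isCommComonObj X := { comul_comm := graph_comul_comm (P := P) X }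
  copy_tensor := graph_copy_tensor (P := P)
  discard_tensor := graph_discard_tensor (P := P)
  copy_unit := congrArg P.graph (by ext)
  discard_unit := (congrArg P.graph (toUnit_unique _ _)).trans (graph_id _)

/-- The cartesian bicategory of relations of `P`. -/
noncomputable def relCBC (P : EED.{u, v, w}) : CBC.{u, w} where
  carrier := P.RelObj
  order X Y := inferInstanceAs (PartialOrder (P.Rel X Y))
  comp_mono := relComp_mono (P := P)
  tensor_mono := relTensor_mono (P := P)
  cocopy X := P.cograph (diag (C := P.base) X)
  codiscard X := P.cograph (toUnit (C := P.base) X)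
  unit_copy X := unit_graph (P := P) (diag (C := P.base) X)
  counit_copy X := counit_graph (P := P) (diag (C := P.base) X)
  unit_discard X := unit_graph (P := P) (toUnit (C := P.base) X)
  counit_discard X := counit_graph (P := P) (toUnit (C := P.base) X)
  frobenius_left := frobenius_left (P := P)
  frobenius_right := frobenius_right (P := P)
  lax_copy := lax_copy (P := P)
  lax_discard := lax_discard (P := P)

end EED

/-! ### Strict cartesian functors and products -/

namespace IsStrictCartesian

variable {C : Type u₁} [Category.{v₁} C] [CartesianMonoidalCategory C]
  {D : Type u₂} [Category.{v₂} D] [CartesianMonoidalCategory D] {F : C ⥤ D}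

/-- The projection is `id × !` followed by the right unitor, all of which `F` preserves. -/
theorem map_fst (hF : IsStrictCartesian F) (X Y : C) :
    HEq (F.map (fst X Y)) (fst (F.obj X) (F.obj Y)) := by
  have e : fst X Y = (𝟙 X ⊗ₘ toUnit Y) ≫ (ρ_ X).hom := by
    rw [id_tensorHom]; exact fst_def X Y
  have h₁ := (conj_eqToHom_iff_heq _ _ (hF.obj_tensor _ _) (hF.obj_tensor _ _)).2
    (hF.map_tensor (𝟙 X) (toUnit Y))
  have h₂ := (conj_eqToHom_iff_heq _ _ (by rw [hF.obj_tensor, hF.obj_unit]) rfl).2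
    (hF.map_rightUnitor X)
  have h₃ : ∀ {U V : D} (h : U = V), eqToHom (congrArg (F.obj X ⊗ ·) h) ≫ fst _ _ = fst _ _ := by
    intro U V h; subst h; simp
  rw [← conj_eqToHom_iff_heq _ _ (hF.obj_tensor _ _) rfl, e, F.map_comp, h₁, h₂]
  simp [rightUnitor_hom, h₃ hF.obj_unit]

theorem eqToHom_map_fst (hF : IsStrictCartesian F) {X Y : C}
    (h : F.obj X ⊗ F.obj Y = F.obj (X ⊗ Y)) : eqToHom h ≫ F.map (fst X Y) = fst _ _ := by
  rw [(conj_eqToHom_iff_heq _ _ h.symm rfl).2 (hF.map_fst X Y)]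
  simp

theorem eqToHom_map_snd (hF : IsStrictCartesian F) {X Y : C}
    (h : F.obj X ⊗ F.obj Y = F.obj (X ⊗ Y)) : eqToHom h ≫ F.map (snd X Y) = snd _ _ := by
  rw [(conj_eqToHom_iff_heq _ _ h.symm rfl).2 (hF.map_snd X Y)]
  simp

theorem eqToHom_fst (hF : IsStrictCartesian F) {X Y : C}
    (h : F.obj (X ⊗ Y) = F.obj X ⊗ F.obj Y) : eqToHom h ≫ fst _ _ = F.map (fst X Y) := by
  rw [← hF.eqToHom_map_fst h.symm]
  simp

theorem eqToHom_snd (hF : IsStrictCartesian F) {X Y : C}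
    (h : F.obj (X ⊗ Y) = F.obj X ⊗ F.obj Y) : eqToHom h ≫ snd _ _ = F.map (snd X Y) := by
  rw [← hF.eqToHom_map_snd h.symm]
  simp

/-- The images of the projections are jointly monic, being the projections of `F X × F Y` up to
transport. -/
theorem map_hom_ext (hF : IsStrictCartesian F) {X Y : C} {Z : D} {f g : Z ⟶ F.obj (X ⊗ Y)}
    (h₁ : f ≫ F.map (fst X Y) = g ≫ F.map (fst X Y))
    (h₂ : f ≫ F.map (snd X Y) = g ≫ F.map (snd X Y)) : f = g := by
  rw [← cancel_mono (eqToHom (hF.obj_tensor X Y))]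
  ext
  · simpa [hF.eqToHom_fst] using h₁
  · simpa [hF.eqToHom_snd] using h₂

theorem map_lift (hF : IsStrictCartesian F) {X Y Z : C} (f : Z ⟶ X) (g : Z ⟶ Y) :
    F.map (lift f g) =
      lift (F.map f) (F.map g) ≫ eqToHom (hF.obj_tensor X Y).symm := by
  refine hF.map_hom_ext ?_ ?_
  · simp [hF.eqToHom_map_fst, ← F.map_comp]
  · simp [hF.eqToHom_map_snd, ← F.map_comp]

theorem map_swap (hF : IsStrictCartesian F) (X Y : C) :
    HEq (F.map (lift (snd X Y) (fst X Y)))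
      (lift (snd (F.obj X) (F.obj Y)) (fst (F.obj X) (F.obj Y))) := by
  rw [← conj_eqToHom_iff_heq _ _ (hF.obj_tensor _ _) (hF.obj_tensor _ _), hF.map_lift]
  rw [comp_lift_assoc, hF.eqToHom_fst, hF.eqToHom_snd]

end IsStrictCartesian

theorem IsStrictMonoidal.map_tensorHom {C : Type u₁} [Category.{v₁} C] [MonoidalCategory C]
    {D : Type u₂} [Category.{v₂} D] [MonoidalCategory D] {F : C ⥤ D} (hF : IsStrictMonoidal F)
    {X X' Y Y' : C} (f : X ⟶ X') (g : Y ⟶ Y') :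
    F.map (f ⊗ₘ g) = eqToHom (hF.obj_tensor X Y) ≫ (F.map f ⊗ₘ F.map g) ≫
      eqToHom (hF.obj_tensor X' Y').symm :=
  (conj_eqToHom_iff_heq _ _ _ (hF.obj_tensor X' Y')).2 (hF.map_tensor f g)

namespace EED

/-! ### The action of a morphism of doctrines on relations -/

variable {P R S : EED.{u, v, w}} (φ : Hom P R)

theorem Hom.b_reindex {X Y : P.base} (f : X ⟶ Y) (α : P.fib.obj (op Y)) :
    φ.b.app (op X) (reindex P.fib f α) = reindex R.fib (φ.F.map f) (φ.b.app (op Y) α) :=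
  ConcreteCategory.congr_hom (φ.b.naturality f.op) α

theorem Hom.b_inf {X : P.base} (α β : P.fib.obj (op X)) :
    φ.b.app (op X) (α ⊓ β) = φ.b.app (op X) α ⊓ φ.b.app (op X) β :=
  map_inf (ConcreteCategory.hom (φ.b.app (op X))) α β

/-- Existence is needed because `ex` along `F.map (snd X Y)`, which occurs in `b_ex`, would
otherwise be a default value. -/
theorem Hom.exists_map_snd (X Y : P.base) :
    ∃ e : R.fib.obj (op (φ.F.obj (X ⊗ Y))) → R.fib.obj (op (φ.F.obj Y)),
      GaloisConnection e (reindex R.fib (φ.F.map (snd X Y))) :=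
  ⟨_, gc_of_iso R.fib (ex_gc R.fib (R.existential.exists_snd _ _))
    (eqToIso (φ.strict.obj_tensor X Y)) (Iso.refl _) (by simp [φ.strict.eqToHom_snd])⟩

/-- The action `r ↦ b_{X × Y}(r)` of `(F, b)` on relations. -/
def mapRel {X Y : P.base} (r : P.Rel X Y) : R.Rel (φ.F.obj X) (φ.F.obj Y) :=
  reindex R.fib (eqToHom (φ.strict.obj_tensor X Y).symm) (φ.b.app (op (X ⊗ Y)) r)

variable {X Y Z : P.base}

theorem mapRel_mono {r s : P.Rel X Y} (h : r ≤ s) : mapRel φ r ≤ mapRel φ s :=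
  reindex_mono _ _ (OrderHomClass.mono (ConcreteCategory.hom (φ.b.app (op (X ⊗ Y)))) h)

theorem mapRel_graph (f : X ⟶ Y) : mapRel φ (P.graph f) = R.graph (φ.F.map f) := by
  rw [mapRel, graph, φ.b_reindex, φ.b_δ, reindex_reindex, reindex_reindex, ← tensorHom_id,
    φ.strict.map_tensorHom]
  simp [graph]

theorem mapRel_cograph (f : X ⟶ Y) : mapRel φ (P.cograph f) = R.cograph (φ.F.map f) := by
  rw [mapRel, cograph, φ.b_reindex, φ.b_δ, reindex_reindex, reindex_reindex, ← id_tensorHom,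
    φ.strict.map_tensorHom]
  simp [cograph]

theorem mapRel_δ (X : P.base) : mapRel φ (P.δ X) = R.δ (φ.F.obj X) := by
  rw [← graph_id, mapRel_graph, φ.F.map_id, graph_id]

theorem mapRel_comp (r : P.Rel X Y) (s : P.Rel Y Z) :
    mapRel φ (P.relComp r s) = R.relComp (mapRel φ r) (mapRel φ s) := by
  -- The transports are made opaque isomorphisms, to be used through their effect on projections.
  obtain ⟨m, hm⟩ : ∃ m : φ.F.obj (X ⊗ Z) ≅ φ.F.obj X ⊗ φ.F.obj Z,
    m = eqToIso (φ.strict.obj_tensor X Z) := ⟨_, rfl⟩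
  obtain ⟨n, hn⟩ : ∃ n : φ.F.obj (Y ⊗ (X ⊗ Z)) ≅ φ.F.obj Y ⊗ φ.F.obj (X ⊗ Z),
    n = eqToIso (φ.strict.obj_tensor Y (X ⊗ Z)) := ⟨_, rfl⟩
  have hm₁ : m.hom ≫ fst _ _ = φ.F.map (fst X Z) := by simp [hm, φ.strict.eqToHom_fst]
  have hm₂ : m.hom ≫ snd _ _ = φ.F.map (snd X Z) := by simp [hm, φ.strict.eqToHom_snd]
  have hn₁ : n.hom ≫ fst _ _ = φ.F.map (fst Y (X ⊗ Z)) := by simp [hn, φ.strict.eqToHom_fst]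
  have hn₂ : n.hom ≫ snd _ _ = φ.F.map (snd Y (X ⊗ Z)) := by simp [hn, φ.strict.eqToHom_snd]
  have hm_inv : eqToHom (φ.strict.obj_tensor X Z).symm = m.inv := by simp [hm]
  -- Identifies `FX × (FY × FZ)` with `F(Y × (X × Z))`, the domain of the quantifier produced by
  -- `b_ex`.
  let t := exchange (φ.F.obj X) (φ.F.obj Y) (φ.F.obj Z) ≪≫ whiskerLeftIso _ m.symm ≪≫ n.symm
  have ht : t.hom ≫ φ.F.map (snd Y (X ⊗ Z)) ≫ m.hom =
      φ.F.obj X ◁ snd (φ.F.obj Y) (φ.F.obj Z) := by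
    simp [t, ← hn₂, exchange]
  rw [mapRel, relComp, relComp, ex_of_iso R.fib (φ.exists_map_snd _ _) t m ht,
    P.existential.ex_middle, φ.b_ex, φ.b_reindex, φ.b_inf, φ.b_reindex, φ.b_reindex, hm_inv]
  simp only [mapRel, reindex_inf, reindex_reindex]
  -- Both sides now quantify along the same map; the remaining equations between reindexing maps are
  -- checked on projections.
  congr 4
  · refine φ.strict.map_hom_ext ?_ ?_
    · have h : ((exchange X Y Z).inv ≫ X ◁ fst Y Z) ≫ fst X Y = snd Y (X ⊗ Z) ≫ fst X Z := by
        simp [exchange]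
      rw [← φ.F.map_comp, ← φ.F.map_comp, h, φ.F.map_comp, ← hm₁, ← hn₂]
      simp [exchange, t, φ.strict.eqToHom_map_fst]
    · have h : ((exchange X Y Z).inv ≫ X ◁ fst Y Z) ≫ snd X Y = fst Y (X ⊗ Z) := by
        simp [exchange]
      rw [← φ.F.map_comp, ← φ.F.map_comp, h, ← hn₁]
      simp [exchange, t, φ.strict.eqToHom_map_snd]
  · refine φ.strict.map_hom_ext ?_ ?_
    · have h : ((exchange X Y Z).inv ≫ snd X (Y ⊗ Z)) ≫ fst Y Z = fst Y (X ⊗ Z) := by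
        simp [exchange]
      rw [← φ.F.map_comp, ← φ.F.map_comp, h, ← hn₁]
      simp [exchange, t, φ.strict.eqToHom_map_fst]
    · have h : ((exchange X Y Z).inv ≫ snd X (Y ⊗ Z)) ≫ snd Y Z = snd Y (X ⊗ Z) ≫ snd X Z := by
        simp [exchange]
      rw [← φ.F.map_comp, ← φ.F.map_comp, h, φ.F.map_comp, ← hm₂, ← hn₂]
      simp [exchange, t, φ.strict.eqToHom_map_snd]

theorem mapRel_tensor {A B : P.base} (r : P.Rel X Y) (s : P.Rel A B) :
    HEq (mapRel φ (P.relTensor r s)) (R.relTensor (mapRel φ r) (mapRel φ s)) := by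
  -- Turns the heterogeneous equality into an ordinary one, with transport expressed as reindexing.
  have key : ∀ {U U' V V' : R.base} (hU : U = U') (hV : V = V') {T : R.Rel U V} {T' : R.Rel U' V'},
      T = reindex R.fib (eqToHom hU ⊗ₘ eqToHom hV) T' → HEq T T' := by
    intro U U' V V' hU hV T T' h
    subst hU hV
    simpa using h
  refine key (φ.strict.obj_tensor _ _) (φ.strict.obj_tensor _ _) ?_
  simp only [mapRel, relTensor, φ.b_inf, φ.b_reindex, reindex_inf, reindex_reindex,
    φ.strict.map_tensorHom]
  congr 2
  · simp [φ.strict.eqToHom_fst]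
  · simp [φ.strict.eqToHom_snd]

theorem graph_heq {X X' Y Y' : R.base} (hX : X = X') (hY : Y = Y') {f : X ⟶ Y} {f' : X' ⟶ Y'}
    (h : HEq f f') : HEq (R.graph f) (R.graph f') := by
  subst hX hY; cases h; rfl

theorem cograph_heq {X X' Y Y' : R.base} (hX : X = X') (hY : Y = Y') {f : X ⟶ Y} {f' : X' ⟶ Y'}
    (h : HEq f f') : HEq (R.cograph f) (R.cograph f') := by
  subst hX hY; cases h; rfl

theorem mapRel_associator (X Y Z : P.base) :
    HEq (mapRel φ (P.graph (α_ X Y Z).hom))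
      (R.graph (α_ (φ.F.obj X) (φ.F.obj Y) (φ.F.obj Z)).hom) := by
  rw [mapRel_graph]
  exact graph_heq (by rw [φ.strict.obj_tensor, φ.strict.obj_tensor])
    (by rw [φ.strict.obj_tensor, φ.strict.obj_tensor]) (φ.strict.map_associator X Y Z)

theorem mapRel_leftUnitor (X : P.base) :
    HEq (mapRel φ (P.graph (λ_ X).hom)) (R.graph (λ_ (φ.F.obj X)).hom) := by
  rw [mapRel_graph]
  exact graph_heq (by rw [φ.strict.obj_tensor, φ.strict.obj_unit]) rfl (φ.strict.map_leftUnitor X)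

theorem mapRel_rightUnitor (X : P.base) :
    HEq (mapRel φ (P.graph (ρ_ X).hom)) (R.graph (ρ_ (φ.F.obj X)).hom) := by
  rw [mapRel_graph]
  exact graph_heq (by rw [φ.strict.obj_tensor, φ.strict.obj_unit]) rfl (φ.strict.map_rightUnitor X)

/-- The morphism of cartesian bicategories induced by a morphism of doctrines. -/
noncomputable def relCBCMap : CBC.Hom P.relCBC R.relCBC where
  F :=
    { obj X := φ.F.obj X
      map r := mapRel φ r
      map_id X := mapRel_δ φ X
      map_comp r s := mapRel_comp φ r s }
  strict :=
    { obj_unit := φ.strict.obj_unit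
      obj_tensor := φ.strict.obj_tensor
      map_tensor r s := mapRel_tensor φ r s
      map_associator := mapRel_associator φ
      map_leftUnitor := mapRel_leftUnitor φ
      map_rightUnitor := mapRel_rightUnitor φ }
  map_braiding X Y := (heq_of_eq (mapRel_graph φ _)).trans
    (graph_heq (φ.strict.obj_tensor _ _) (φ.strict.obj_tensor _ _) (φ.strict.map_swap X Y))
  mono h := mapRel_mono φ h
  map_copy X := (heq_of_eq (mapRel_graph φ _)).trans
    (graph_heq rfl (φ.strict.obj_tensor _ _) (φ.strict.map_diag X))
  map_discard X := (heq_of_eq (mapRel_graph φ _)).trans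
    (graph_heq rfl φ.strict.obj_unit (φ.strict.map_toUnit X))
  map_cocopy X := (heq_of_eq (mapRel_cograph φ _)).trans
    (cograph_heq rfl (φ.strict.obj_tensor _ _) (φ.strict.map_diag X))
  map_codiscard X := (heq_of_eq (mapRel_cograph φ _)).trans
    (cograph_heq rfl φ.strict.obj_unit (φ.strict.map_toUnit X))

/-- The functor that sends a doctrine to its cartesian bicategory of relations. -/
noncomputable def relFunctor : EED.{u, v, w} ⥤ CBC.{u, w} where
  obj P := P.relCBC
  map φ := relCBCMap φ
  map_id P := CBC.Hom.ext' (Functor.hext (fun _ => rfl) fun X Y r => heq_of_eq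
    (reindex_id P.fib r))
  map_comp {P R S} φ ψ := CBC.Hom.ext' (Functor.hext (fun _ => rfl) fun X Y r => heq_of_eq <| by
    change mapRel (Hom.comp φ ψ) r = mapRel ψ (mapRel φ r)
    simp only [mapRel, ψ.b_reindex, reindex_reindex, eqToHom_map, eqToHom_trans]
    rfl)

end EED

end DoctrineCB

/-- The compatibility equation holds by `rfl`, since `relFunctor` is built from precisely the data
recorded in `rel`. -/
theorem mainTheorem2 :
    (∀ P : DoctrineCB.EED.{u, v, w},
      (∀ X : P.base, P.graph (𝟙 X) = P.δ X) ∧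
      (∀ (X Y Z : P.base) (f : X ⟶ Y) (g : Y ⟶ Z),
        P.graph (f ≫ g) = P.relComp (P.graph f) (P.graph g)) ∧
      (∀ (X X' Y Y' : P.base) (f : X ⟶ X') (g : Y ⟶ Y'),
        P.graph (f ⊗ₘ g) = P.relTensor (P.graph f) (P.graph g))) ∧
    ∃ L : DoctrineCB.EED.{u, v, w} ⥤ DoctrineCB.CBC.{u, w},
      L.toPrefunctor ⋙q DoctrineCB.CBC.toData = DoctrineCB.EED.rel :=
  ⟨fun _ => ⟨DoctrineCB.EED.graph_id, fun _ _ _ => DoctrineCB.EED.graph_comp,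
    fun _ _ _ _ => DoctrineCB.EED.graph_tensor⟩, DoctrineCB.EED.relFunctor, rfl⟩
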